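/- Let $(W,S)$ be a Coxeter system of finite rank $n$, $S=\{s_1,\dots,s_n\}$, with orders $m_{ij}\in\{1,2,3,\dots\}\cup\{\infty\}$ of $s_is_j$. Let $V=\mathbb R^n$ with the Euclidean inner product and orthonormal basis $\Delta=\{\alpha_1,\dots,\alpha_n\}$ (the simple roots), and let $B$ be a symmetric bilinear form on $V$ with $B(\alpha_i,\alpha_j)=-\cos(\pi/m_{ij})$ if $m_{ij}<\infty$ and $B(\alpha_i,\alpha_j)\le -1$ if $m_{ij}=\infty$. Assume that $B$ has signature $(n-1,1)$ and that its Gram matrix is irreducible (not block-diagonal up to a permutation of the basis). Let $W$ act linearly on $V$ by letting $s_i$ act as $v\mapsto v-2B(\alpha_i,v)\alpha_i$, and let $\Phi=W(\Delta)$ be the set of roots. There is exactly one eigenvector $o$ of the Gram matrix for a negative eigenvalue which has Euclidean norm $1$ and only positive coordinates. Put $|v|_1=\sum_i o_iv_i$, and $\widehat v=v/|v|_1$ if $|v|_1\ne0$; let $w\cdot v=\widehat{w(v)}$ be the normalized action, and let $$D=\{v:\ |v|_1=1,\ B(v,v)<0\},\qquad \partial D=\{v:\ |v|_1=1,\ B(v,v)=0\}.$$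 Let $\Lambda(W)$ be the set of accumulation points of the orbit $\{w\cdot o: w\in W\}$, and $E(W)$ the set of accumulation points of the set $\{\widehat\rho:\rho\in\Phi\}$ of normalized roots, both in the Euclidean topology. Then $\Lambda(W)=E(W)$. Moreover, for every sequence $(w_k)$ in $W$, every $\delta\in\Delta$, every $y\in D$ and every $z\in\partial D$: 1. if $w_k\cdot\widehat\delta\to z$, then $w_k\cdot y\to z$; 2. conversely, if $w_k\cdot y\to z$ and no root equals $w_k(\delta)$ for infinitely many $k$, then $w_k\cdot\widehat\delta\to z$. -/

import Mathlib

open Filter Topology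

noncomputable section

/-- A Gram matrix for the Coxeter matrix `M` (Mathlib's convention: the entry `0` of `M` stands for
`∞`). Its entries are `-cos (π / mᵢⱼ)` if `mᵢⱼ` is finite, and arbitrary real numbers `≤ -1` if
`mᵢⱼ = ∞`. The diagonal entries are `-cos π = 1`. -/
structure CoxeterGram {ι : Type*} (M : CoxeterMatrix ι) where
  /-- the underlying matrix -/
  mat : Matrix ι ι ℝ
  symm : ∀ i j, mat i j = mat j i
  of_finite : ∀ i j, M i j ≠ 0 → mat i j = -Real.cos (Real.pi / M i j)
  of_infinite : ∀ i j, M i j = 0 → mat i j ≤ -1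

namespace CoxeterGram

/-- The simple root `α_i`: the standard orthonormal basis vector of index `i`. -/
def simpleRoot {ι : Type*} [DecidableEq ι] (i : ι) : EuclideanSpace ℝ ι :=
  EuclideanSpace.single i 1

/-- The symmetric bilinear form `B` with `B (α_i, α_j)` the `(i, j)` entry of the Gram matrix. -/
def form {ι : Type*} [Fintype ι] [DecidableEq ι] {M : CoxeterMatrix ι} (G : CoxeterGram M) :
    LinearMap.BilinForm ℝ (EuclideanSpace ℝ ι) :=
  Matrix.toBilin (EuclideanSpace.basisFun ι ℝ).toBasis G.mat

/-- The quadratic form `q v = B (v, v)`. -/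
def quad {ι : Type*} [Fintype ι] [DecidableEq ι] {M : CoxeterMatrix ι} (G : CoxeterGram M) :
    QuadraticForm ℝ (EuclideanSpace ℝ ι) :=
  G.form.toQuadraticMap

/-- `B` has signature `(n - 1, 1)`, where `n` is the rank. -/
def IsLorentzian {ι : Type*} [Fintype ι] [DecidableEq ι] {M : CoxeterMatrix ι}
    (G : CoxeterGram M) : Prop :=
  sigPos G.quad + 1 = Fintype.card ι ∧ sigNeg G.quad = 1

/-- The Gram matrix is not block-diagonal up to a permutation of the basis. -/
def IsIrreducible {ι : Type*} {M : CoxeterMatrix ι} (G : CoxeterGram M) : Prop :=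
  ∀ I : Set ι, I.Nonempty → Iᶜ.Nonempty → ∃ i ∈ I, ∃ j ∈ Iᶜ, G.mat i j ≠ 0

theorem form_simpleRoot {ι : Type*} [Fintype ι] [DecidableEq ι] {M : CoxeterMatrix ι}
    (G : CoxeterGram M) (i j : ι) : G.form (simpleRoot i) (simpleRoot j) = G.mat i j := by
  have h : ∀ k : ι, (simpleRoot k : EuclideanSpace ℝ ι)
      = (EuclideanSpace.basisFun ι ℝ).toBasis k := by
    intro k
    simp [simpleRoot]
  rw [form, h, h, Matrix.toBilin_apply]
  simp

theorem mat_diag {ι : Type*} {M : CoxeterMatrix ι} (G : CoxeterGram M) (i : ι) :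
    G.mat i i = 1 := by
  rw [G.of_finite i i (by simp)]
  simp

theorem two_form_self {ι : Type*} [Fintype ι] [DecidableEq ι] {M : CoxeterMatrix ι}
    (G : CoxeterGram M) (i : ι) :
    ((2 : ℝ) • G.form (simpleRoot i)) (simpleRoot i) = 2 := by
  simp [form_simpleRoot, mat_diag]

/-- The `B`-reflection `v ↦ v - 2 B(α_i, v) α_i` in the simple root `α_i` (note
`B(α_i, α_i) = 1`). -/
def simpleReflection {ι : Type*} [Fintype ι] [DecidableEq ι] {M : CoxeterMatrix ι}
    (G : CoxeterGram M) (i : ι) : EuclideanSpace ℝ ι ≃ₗ[ℝ] EuclideanSpace ℝ ι :=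
  Module.reflection (G.two_form_self i)

theorem simpleReflection_apply {ι : Type*} [Fintype ι] [DecidableEq ι] {M : CoxeterMatrix ι}
    (G : CoxeterGram M) (i : ι) (v : EuclideanSpace ℝ ι) :
    G.simpleReflection i v = v - (2 * G.form (simpleRoot i) v) • simpleRoot i := by
  simp [simpleReflection, Module.reflection_apply]

/-- The simple reflections satisfy the Coxeter relations. -/
theorem isLiftable {ι : Type*} [Fintype ι] [DecidableEq ι] {M : CoxeterMatrix ι}
    (G : CoxeterGram M) : M.IsLiftable G.simpleReflection := by
  intro i j
  ext1 z
  by_cases h0 : M i j = 0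
  · simp [h0]
  by_cases hij : i = j
  · subst hij
    rw [M.diagonal, pow_one]
    exact Module.involutive_reflection (G.two_form_self i) z
  have h1 := M.off_diagonal i j hij
  have hg := G.of_finite i j h0
  simp only [simpleReflection]
  rw [Module.reflection_mul_reflection_pow_apply (G.two_form_self i) (G.two_form_self j) (M i j) z
    (t := 2 * Real.cos (2 * (Real.pi / M i j))) (ht := by
      rw [Real.cos_two_mul]
      simp [form_simpleRoot, G.symm j i, hg]
      ring)]
  generalize hm : M i j = m at *
  by_cases h2 : m = 2
  · subst h2
    have hz : G.mat i j = 0 := by rw [hg]; simp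
    have hz' : G.mat j i = 0 := by rw [G.symm]; exact hz
    have hc : 2 * (Real.pi / ((2 : ℕ) : ℝ)) = Real.pi := by push_cast; ring
    rw [hc, Real.cos_pi]
    simp [form_simpleRoot, hz, hz']
    module
  have hm3 : (3 : ℝ) ≤ m := by exact_mod_cast (show 3 ≤ m by omega)
  set θ : ℝ := 2 * (Real.pi / m) with hθ
  have hmθ : (m : ℝ) * θ = 2 * Real.pi := by
    rw [hθ]; field_simp
  have hpos : 0 < θ := by positivity
  have hlt : θ < Real.pi := by nlinarith [Real.pi_pos]
  have hs : Real.sin θ ≠ 0 := (Real.sin_pos_of_pos_of_lt_pi hpos hlt).ne'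
  rcases Nat.even_or_odd' m with ⟨k, hk | hk⟩
  · have e1 : ((m : ℤ) - 2) / 2 = (k : ℤ) - 1 := by omega
    have e2 : ((m : ℤ) - 1) / 2 = (k : ℤ) - 1 := by omega
    have hS : (Polynomial.Chebyshev.S ℝ ((k : ℤ) - 1)).eval (2 * Real.cos θ) = 0 := by
      have h := Polynomial.Chebyshev.S_two_mul_real_cos θ ((k : ℤ) - 1)
      have hk' : (k : ℝ) * θ = Real.pi := by
        rw [hk] at hmθ; push_cast at hmθ; linarith
      push_cast at h
      rw [sub_add_cancel, hk', Real.sin_pi] at h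
      exact (mul_eq_zero.mp h).resolve_right hs
    rw [e1, e2, hS]
    simp
  · have e1 : ((m : ℤ) - 2) / 2 = (k : ℤ) - 1 := by omega
    have e2 : ((m : ℤ) - 1) / 2 = (k : ℤ) := by omega
    have e3 : ((m : ℤ) - 3) / 2 = (k : ℤ) - 1 := by omega
    have e4 : (m : ℤ) / 2 = (k : ℤ) := by omega
    have hS : (Polynomial.Chebyshev.S ℝ (k : ℤ)).eval (2 * Real.cos θ)
        + (Polynomial.Chebyshev.S ℝ ((k : ℤ) - 1)).eval (2 * Real.cos θ) = 0 := by
      have h := Polynomial.Chebyshev.S_two_mul_real_cos θ ((k : ℤ) - 1)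
      have h' := Polynomial.Chebyshev.S_two_mul_real_cos θ (k : ℤ)
      have hk' : ((k : ℝ) + 1) * θ = 2 * Real.pi - k * θ := by
        rw [hk] at hmθ; push_cast at hmθ; linarith
      push_cast at h h'
      rw [hk', Real.sin_two_pi_sub] at h'
      rw [sub_add_cancel] at h
      refine (mul_eq_zero.mp ?_).resolve_right hs
      rw [add_mul, h, h']
      ring
    rw [e1, e2, e3, e4, hS]
    simp

/-- The action of `W` on `V` in which each generator acts by the `B`-reflection in the
corresponding simple root. -/
def rep {ι : Type*} [Fintype ι] [DecidableEq ι] {W : Type*} [Group W] {M : CoxeterMatrix ι}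
    (G : CoxeterGram M) (cs : CoxeterSystem M W) :
    W →* (EuclideanSpace ℝ ι ≃ₗ[ℝ] EuclideanSpace ℝ ι) :=
  cs.lift ⟨G.simpleReflection, G.isLiftable⟩

theorem rep_simple {ι : Type*} [Fintype ι] [DecidableEq ι] {W : Type*} [Group W]
    {M : CoxeterMatrix ι} (G : CoxeterGram M) (cs : CoxeterSystem M W) (i : ι) :
    G.rep cs (cs.simple i) = G.simpleReflection i :=
  cs.lift_apply_simple G.isLiftable i

/-- The root system `Φ`: the orbit of the simple roots under `W`. -/
def roots {ι : Type*} [Fintype ι] [DecidableEq ι] {W : Type*} [Group W] {M : CoxeterMatrix ι}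
    (G : CoxeterGram M) (cs : CoxeterSystem M W) : Set (EuclideanSpace ℝ ι) :=
  {v | ∃ (w : W) (i : ι), v = G.rep cs w (simpleRoot i)}

/-- `o` is the eigenvector for the negative eigenvalue of the Gram matrix that has Euclidean norm
one and positive coordinates. -/
def IsNormalizedEigenvector {ι : Type*} [Fintype ι] [DecidableEq ι] {M : CoxeterMatrix ι}
    (G : CoxeterGram M) (o : EuclideanSpace ℝ ι) : Prop :=
  (∃ c : ℝ, c < 0 ∧ Module.End.HasEigenvector (Matrix.toEuclideanLin G.mat) c o) ∧
    ‖o‖ = 1 ∧ ∀ i, 0 < o i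

/-- `|v|₁ = ∑ oᵢ vᵢ`. -/
def height {ι : Type*} [Fintype ι] (o v : EuclideanSpace ℝ ι) : ℝ :=
  ∑ i, o i * v i

/-- The normalized vector `v̂ = v / |v|₁` of a vector with `|v|₁ ≠ 0`. -/
def hat {ι : Type*} [Fintype ι] (o v : EuclideanSpace ℝ ι) : EuclideanSpace ℝ ι :=
  (height o v)⁻¹ • v

/-- The normalized action: `w · v` is the normalization of `w(v)`. -/
def act {ι : Type*} [Fintype ι] [DecidableEq ι] {W : Type*} [Group W] {M : CoxeterMatrix ι}
    (G : CoxeterGram M) (cs : CoxeterSystem M W) (o : EuclideanSpace ℝ ι) (w : W)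
    (v : EuclideanSpace ℝ ι) : EuclideanSpace ℝ ι :=
  hat o (G.rep cs w v)

/-- The region `D`: the vectors with `|v|₁ = 1` and `q v < 0` (the interior of an ellipsoid in
the affine hyperplane `|v|₁ = 1`). -/
def region {ι : Type*} [Fintype ι] [DecidableEq ι] {M : CoxeterMatrix ι}
    (G : CoxeterGram M) (o : EuclideanSpace ℝ ι) : Set (EuclideanSpace ℝ ι) :=
  {v | height o v = 1 ∧ G.quad v < 0}

/-- The boundary `∂D` of `D` in the affine hyperplane: the vectors with `|v|₁ = 1` and
`q v = 0`. -/
def regionBoundary {ι : Type*} [Fintype ι] [DecidableEq ι] {M : CoxeterMatrix ι}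
    (G : CoxeterGram M) (o : EuclideanSpace ℝ ι) : Set (EuclideanSpace ℝ ι) :=
  {v | height o v = 1 ∧ G.quad v = 0}

/-- `E(W)`: the set of accumulation points of the normalized roots. -/
def accRoots {ι : Type*} [Fintype ι] [DecidableEq ι] {W : Type*} [Group W] {M : CoxeterMatrix ι}
    (G : CoxeterGram M) (cs : CoxeterSystem M W) (o : EuclideanSpace ℝ ι) :
    Set (EuclideanSpace ℝ ι) :=
  derivedSet (hat o '' G.roots cs)

/-- The limit set `Λ(W)`: the set of accumulation points of the orbit of `o` under the
normalized action. -/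
def limitSet {ι : Type*} [Fintype ι] [DecidableEq ι] {W : Type*} [Group W] {M : CoxeterMatrix ι}
    (G : CoxeterGram M) (cs : CoxeterSystem M W) (o : EuclideanSpace ℝ ι) :
    Set (EuclideanSpace ℝ ι) :=
  derivedSet (Set.range fun w : W => G.act cs o w o)

end CoxeterGram

end

/-! Write `h` for the height and `q` for the quadratic form. By the signature, `q` is positive
definite on `h = 0`: a nonzero `v` there with `q v ≤ 0` would span with `o` a plane on which `q ≤
0`. Hence, for some `μ > 0`, two vectors `x`, `r` of height 1 satisfy `μ‖x - r‖² ≤ q x + q r - 2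
B(x, r)`. Apply this to `x = w · y` with `y` in `D` and to the normalized root `r` of `w(δ)`. Then
`q x < 0`, `q r = h(wδ)⁻²`, and `B(x, r) = B(y, δ) / (h(wy) h(wδ))`, where `|h(wy)|` is bounded
below by the reversed Cauchy-Schwarz inequality. So the two points approach each other as soon as
`|h(wδ)| → ∞` (`tendsto_act_sub_hat`), and every claim reduces to this divergence. If the normalized
roots tend to a point with `q = 0`, divergence is immediate from `q r = h(wδ)⁻²`. Otherwise it comes
from discreteness: only finitely many `w` keep `h(wo)` bounded (`finite_abs_height_rep_le`), and
hence only finitely many roots have bounded height (`finite_roots_abs_height_le`). Both rest on the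
fact that every root has coordinates of a single sign, proved by reduction to dihedral subgroups. -/

noncomputable section

/-! ### Coefficients of roots in rank two -/

/-- The Chebyshev-type sequence `p₀ = 0`, `p₁ = 1`, `pₙ₊₂ = 2 a pₙ₊₁ - pₙ`. -/
def chebyshevSeq (a : ℝ) : ℕ → ℝ
  | 0 => 0
  | 1 => 1
  | n + 2 => 2 * a * chebyshevSeq a (n + 1) - chebyshevSeq a n

theorem sin_mul_chebyshevSeq_cos (θ : ℝ) (n : ℕ) :
    Real.sin θ * chebyshevSeq (Real.cos θ) n = Real.sin (n * θ) := by
  induction n using Nat.twoStepInduction with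
  | zero => simp [chebyshevSeq]
  | one => simp [chebyshevSeq]
  | more n h0 h1 =>
    have e0 : (n : ℝ) * θ = ((n + 1 : ℕ) : ℝ) * θ - θ := by push_cast; ring
    have e2 : ((n + 2 : ℕ) : ℝ) * θ = ((n + 1 : ℕ) : ℝ) * θ + θ := by push_cast; ring
    rw [chebyshevSeq, mul_sub, h0, show Real.sin θ * (2 * Real.cos θ *
      chebyshevSeq (Real.cos θ) (n + 1)) = 2 * Real.cos θ * (Real.sin θ *
      chebyshevSeq (Real.cos θ) (n + 1)) by ring, h1, e0, e2, Real.sin_add, Real.sin_sub]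
    ring

/-- The recursion subtracts a term, so monotonicity has to be carried through the induction. This is
the case of an infinite dihedral subgroup. -/
theorem chebyshevSeq_nonneg_and_le {a : ℝ} (ha : 1 ≤ a) (n : ℕ) :
    0 ≤ chebyshevSeq a n ∧ chebyshevSeq a n ≤ chebyshevSeq a (n + 1) := by
  induction n with
  | zero => simp [chebyshevSeq]
  | succ n ih =>
    obtain ⟨h0, h1⟩ := ih
    refine ⟨h0.trans h1, ?_⟩
    rw [chebyshevSeq]
    nlinarith

/-- The value is `sin (nπ/m) / sin (π/m)`, and `nπ/m` does not exceed `π`. This is the case of a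
finite dihedral subgroup. -/
theorem chebyshevSeq_cos_pi_div_nonneg {m n : ℕ} (hm : 2 ≤ m) (hn : n ≤ m) :
    0 ≤ chebyshevSeq (Real.cos (Real.pi / m)) n := by
  have hm' : (2 : ℝ) ≤ m := by exact_mod_cast hm
  have hn' : (n : ℝ) ≤ m := by exact_mod_cast hn
  have hs : 0 < Real.sin (Real.pi / m) := by
    apply Real.sin_pos_of_pos_of_lt_pi (by positivity)
    rw [div_lt_iff₀ (by linarith)]
    nlinarith [Real.pi_pos]
  have h : 0 ≤ Real.sin (n * (Real.pi / m)) := by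
    apply Real.sin_nonneg_of_nonneg_of_le_pi (by positivity)
    rw [← mul_div_assoc, div_le_iff₀ (by linarith)]
    nlinarith [Real.pi_pos]
  rw [← sin_mul_chebyshevSeq_cos] at h
  exact nonneg_of_mul_nonneg_right h hs

/-! ### Dihedral factorization of group elements -/

namespace CoxeterSystem

/-- For `w` with right descent `t`, strip a maximal alternating word in `s, t` off the right. -/
theorem exists_eq_mul_alternatingWord {ι W : Type*} [Group W] {M : CoxeterMatrix ι}
    (cs : CoxeterSystem M W) (w : W) {s t : ι} (ht : cs.IsRightDescent w t) :
    ∃ (v : W) (j : ℕ), w = v * cs.wordProd (alternatingWord s t j) ∧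
      cs.length w = cs.length v + j ∧ 0 < j ∧
      ¬ cs.IsRightDescent v s ∧ ¬ cs.IsRightDescent v t := by
  classical
  let P : ℕ → Prop := fun j => ∃ v : W,
    w = v * cs.wordProd (alternatingWord s t j) ∧ cs.length w = cs.length v + j
  have h1 : P 1 := by
    refine ⟨w * cs.simple t, ?_, ?_⟩
    · simp [alternatingWord]
    · exact ((cs.isRightDescent_iff).1 ht).symm
  have hw : 1 ≤ cs.length w := by
    have : cs.length (w * cs.simple t) < cs.length w := ht
    omega
  set j := Nat.findGreatest P (cs.length w) with hj
  obtain ⟨v, hv, hl⟩ : P j := Nat.findGreatest_spec hw h1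
  have hj0 : 1 ≤ j := Nat.le_findGreatest hw h1
  have hnext : ¬ P (j + 1) := by
    intro h
    have hle : j + 1 ≤ cs.length w := by
      obtain ⟨v', -, h'⟩ := h
      omega
    have := Nat.le_findGreatest hle h
    omega
  refine ⟨v, j, hv, hl, hj0, ?_⟩
  -- This letter would prolong the alternating word on the left, against the maximality of `j`.
  have hnot : ¬ cs.IsRightDescent v (if Even j then t else s) := by
    intro h
    apply hnext
    refine ⟨v * cs.simple (if Even j then t else s), ?_, ?_⟩
    · rw [alternatingWord_succ', wordProd_cons, ← mul_assoc,
        cs.simple_mul_simple_cancel_right]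
      exact hv
    · have := (cs.isRightDescent_iff).1 h
      omega
  -- This letter is the first one of the alternating word; if it also shortened `v`, then `w` would
  -- be shorter than `ℓ(v) + j`.
  have hprev : ¬ cs.IsRightDescent v (if Even j then s else t) := by
    intro h
    obtain ⟨k, hk⟩ : ∃ k, j = k + 1 := ⟨j - 1, by omega⟩
    have he : (if Even j then s else t) = if Even k then t else s := by
      rw [hk]
      by_cases hk2 : Even k <;> simp [hk2, Nat.even_add_one]
    rw [he] at h
    have hw' : w = v * cs.simple (if Even k then t else s) *
        cs.wordProd (alternatingWord s t k) := by
      rw [hv, hk, alternatingWord_succ', wordProd_cons, mul_assoc]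
    have h2 := cs.length_mul_le (v * cs.simple (if Even k then t else s))
      (cs.wordProd (alternatingWord s t k))
    rw [← hw'] at h2
    have h3 := cs.length_wordProd_le (alternatingWord s t k)
    rw [length_alternatingWord] at h3
    have h4 : cs.length (v * cs.simple (if Even k then t else s)) < cs.length v := h
    omega
  by_cases hj2 : Even j <;> simp only [hj2, if_true, if_false] at hnot hprev
  · exact ⟨hprev, hnot⟩
  · exact ⟨hnot, hprev⟩

end CoxeterSystem

/-! ### Every root is positive or negative -/

namespace CoxeterGram

variable {ι : Type*} [Fintype ι] [DecidableEq ι] {W : Type*} [Group W] {M : CoxeterMatrix ι}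

theorem simpleReflection_simpleRoot (G : CoxeterGram M) (i j : ι) :
    G.simpleReflection i (simpleRoot j) = simpleRoot j - (2 * G.mat i j) • simpleRoot i := by
  rw [simpleReflection_apply, form_simpleRoot]

theorem simpleReflection_simpleRoot_self (G : CoxeterGram M) (i : ι) :
    G.simpleReflection i (simpleRoot i) = -simpleRoot i := by
  rw [simpleReflection_simpleRoot, mat_diag]
  module

/-- The orbit of `α_s` under the dihedral subgroup stays in the plane of `α_s` and `α_t`; each new
letter changes one of the two coefficients by the Chebyshev recursion. -/
theorem rep_wordProd_alternatingWord (G : CoxeterGram M) (cs : CoxeterSystem M W) (s t : ι)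
    (j : ℕ) :
    G.rep cs (cs.wordProd (CoxeterSystem.alternatingWord s t j)) (simpleRoot s) =
      chebyshevSeq (-G.mat s t) (j + 1) • simpleRoot (if Even j then s else t) +
        chebyshevSeq (-G.mat s t) j • simpleRoot (if Even j then t else s) := by
  induction j with
  | zero => simp [CoxeterSystem.alternatingWord, chebyshevSeq]
  | succ j ih =>
    rw [CoxeterSystem.alternatingWord_succ', CoxeterSystem.wordProd_cons, map_mul,
      LinearEquiv.mul_apply, ih, map_add, map_smul, map_smul, rep_simple, chebyshevSeq]
    by_cases hj : Even j
    · simp only [hj, if_true, Nat.even_add_one, not_true, if_false,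
        simpleReflection_simpleRoot_self, simpleReflection_simpleRoot, G.symm t s]
      module
    · simp only [hj, if_false, Nat.even_add_one, not_false_eq_true, if_true,
        simpleReflection_simpleRoot_self, simpleReflection_simpleRoot]
      module

/-- If `s` is not a right descent of `w`, then `w (α_s)` has nonnegative coordinates. -/
theorem rep_simpleRoot_nonneg (G : CoxeterGram M) (cs : CoxeterSystem M W) (w : W) (s : ι)
    (hs : ¬ cs.IsRightDescent w s) (i : ι) : 0 ≤ G.rep cs w (simpleRoot s) i := by
  induction hn : cs.length w using Nat.strong_induction_on generalizing w s with
  | _ n IH =>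
  subst hn
  by_cases hw : w = 1
  · subst hw
    simp only [map_one, LinearEquiv.coe_one, id, simpleRoot, PiLp.single_apply]
    split_ifs <;> norm_num
  obtain ⟨t, ht⟩ := cs.exists_rightDescent_of_ne_one hw
  have hst : s ≠ t := by rintro rfl; exact hs ht
  obtain ⟨v, j, hv, hl, hj, hvs, hvt⟩ := cs.exists_eq_mul_alternatingWord (s := s) w ht
  have hs' := IH _ (by omega) v s hvs rfl
  have ht' := IH _ (by omega) v t hvt rfl
  -- As `ws` is longer than `w`, the alternating word with `s` appended is reduced. This bounds `j +
  -- 1` by `m_{st}`, the range in which the coefficients are nonnegative.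
  have hred : cs.IsReduced (CoxeterSystem.alternatingWord t s (j + 1)) := by
    have h1 := (cs.not_isRightDescent_iff).1 hs
    have h2 : w * cs.simple s =
        v * cs.wordProd (CoxeterSystem.alternatingWord t s (j + 1)) := by
      rw [CoxeterSystem.alternatingWord_succ, CoxeterSystem.wordProd_concat, ← mul_assoc, ← hv]
    have h3 := cs.length_mul_le v (cs.wordProd (CoxeterSystem.alternatingWord t s (j + 1)))
    rw [← h2] at h3
    have h4 := cs.length_wordProd_le (CoxeterSystem.alternatingWord t s (j + 1))
    rw [CoxeterSystem.length_alternatingWord] at h4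
    rw [CoxeterSystem.IsReduced, CoxeterSystem.length_alternatingWord]
    omega
  have hp : 0 ≤ chebyshevSeq (-G.mat s t) j ∧ 0 ≤ chebyshevSeq (-G.mat s t) (j + 1) := by
    by_cases h0 : M s t = 0
    · have ha : 1 ≤ -G.mat s t := by linarith [G.of_infinite s t h0]
      exact ⟨(chebyshevSeq_nonneg_and_le ha j).1, (chebyshevSeq_nonneg_and_le ha _).1⟩
    · have h1 := M.off_diagonal s t hst
      have hle : j + 1 ≤ M s t := by
        by_contra hlt
        exact cs.not_isReduced_alternatingWord t s (by rwa [M.symmetric t s])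
          (by rw [M.symmetric t s]; omega) hred
      rw [G.of_finite s t h0, neg_neg]
      exact ⟨chebyshevSeq_cos_pi_div_nonneg (by omega) (by omega),
        chebyshevSeq_cos_pi_div_nonneg (by omega) hle⟩
  rw [hv, map_mul, LinearEquiv.mul_apply, rep_wordProd_alternatingWord, map_add, map_smul,
    map_smul]
  simp only [PiLp.add_apply, PiLp.smul_apply, smul_eq_mul]
  split_ifs
  · exact add_nonneg (mul_nonneg hp.2 hs') (mul_nonneg hp.1 ht')
  · exact add_nonneg (mul_nonneg hp.2 ht') (mul_nonneg hp.1 hs')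

/-- If `s` is a right descent of `w`, then `w (α_s)` has nonpositive coordinates. -/
theorem rep_simpleRoot_nonpos (G : CoxeterGram M) (cs : CoxeterSystem M W) (w : W) (s : ι)
    (hs : cs.IsRightDescent w s) (i : ι) : G.rep cs w (simpleRoot s) i ≤ 0 := by
  have h := G.rep_simpleRoot_nonneg cs (w * cs.simple s) s
    ((cs.isRightDescent_iff_not_isRightDescent_mul).1 hs) i
  rw [map_mul, LinearEquiv.mul_apply, rep_simple, simpleReflection_simpleRoot_self, map_neg] at h
  simpa using h

end CoxeterGram

/-! ### The eigenvector `o` and definiteness on height zero -/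

namespace CoxeterGram

theorem mat_nonpos {ι : Type*} {M : CoxeterMatrix ι} (G : CoxeterGram M) {i j : ι} (hij : i ≠ j) : G.mat i j ≤ 0 := by
  by_cases h0 : M i j = 0
  · linarith [G.of_infinite i j h0]
  · have h1 := M.off_diagonal i j hij
    have h2 : (2 : ℝ) ≤ M i j := by exact_mod_cast (show 2 ≤ M i j by omega)
    rw [G.of_finite i j h0, neg_nonpos]
    apply Real.cos_nonneg_of_neg_pi_div_two_le_of_le
    · have : 0 ≤ Real.pi / M i j := by positivity
      linarith [Real.pi_pos]
    · exact div_le_div_of_nonneg_left Real.pi_pos.le (by norm_num) h2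

section Height

variable {ι : Type*} [Fintype ι]

theorem height_eq_inner (o v : EuclideanSpace ℝ ι) : height o v = inner ℝ o v := by
  simp [height, PiLp.inner_apply, mul_comm]

theorem height_smul (o v : EuclideanSpace ℝ ι) (a : ℝ) : height o (a • v) = a * height o v := by
  simp [height_eq_inner, inner_smul_right]

theorem height_sub (o v w : EuclideanSpace ℝ ι) :
    height o (v - w) = height o v - height o w := by
  simp [height_eq_inner, inner_sub_right]

end Height

variable {ι : Type*} [Fintype ι] [DecidableEq ι] {W : Type*} [Group W] {M : CoxeterMatrix ι}

theorem height_simpleRoot (o : EuclideanSpace ℝ ι) (i : ι) : height o (simpleRoot i) = o i := by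
  simp [height, simpleRoot]

theorem form_apply (G : CoxeterGram M) (x y : EuclideanSpace ℝ ι) :
    G.form x y = ∑ i, ∑ j, x i * G.mat i j * y j := by
  simp [form, Matrix.toBilin_apply]

theorem form_eq_inner (G : CoxeterGram M) (x y : EuclideanSpace ℝ ι) :
    G.form x y = inner ℝ x (Matrix.toEuclideanLin G.mat y) := by
  simp only [form_apply, PiLp.inner_apply, Matrix.ofLp_toLpLin, Matrix.toLin'_apply, Matrix.mulVec,
    dotProduct, RCLike.inner_apply, conj_trivial, Finset.sum_mul]
  exact Finset.sum_congr rfl fun i _ => Finset.sum_congr rfl fun j _ => by ring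

theorem form_comm (G : CoxeterGram M) (x y : EuclideanSpace ℝ ι) : G.form x y = G.form y x := by
  rw [form_apply, form_apply, Finset.sum_comm]
  exact Finset.sum_congr rfl fun i _ => Finset.sum_congr rfl fun j _ => by rw [G.symm]; ring

theorem quad_apply (G : CoxeterGram M) (x : EuclideanSpace ℝ ι) : G.quad x = G.form x x := rfl

theorem continuous_form_left (G : CoxeterGram M) (y : EuclideanSpace ℝ ι) :
    Continuous fun x => G.form x y := by
  simp only [form_apply]
  fun_prop

theorem continuous_quad (G : CoxeterGram M) : Continuous fun x => G.quad x := by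
  simp only [quad_apply, form_apply]
  fun_prop

theorem form_rep (G : CoxeterGram M) (cs : CoxeterSystem M W) (w : W)
    (x y : EuclideanSpace ℝ ι) : G.form (G.rep cs w x) (G.rep cs w y) = G.form x y := by
  induction w using cs.simple_induction generalizing x y with
  | simple i =>
    rw [rep_simple, simpleReflection_apply, simpleReflection_apply]
    simp only [map_sub, LinearMap.sub_apply, map_smul, LinearMap.smul_apply, smul_eq_mul,
      form_simpleRoot, mat_diag, G.form_comm x (simpleRoot i)]
    ring
  | one => simp
  | mul w w' h h' => rw [map_mul, LinearEquiv.mul_apply, LinearEquiv.mul_apply, h, h']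

theorem quad_rep (G : CoxeterGram M) (cs : CoxeterSystem M W) (w : W)
    (x : EuclideanSpace ℝ ι) : G.quad (G.rep cs w x) = G.quad x :=
  G.form_rep cs w x x

theorem exists_quad_neg (G : CoxeterGram M) (hsig : G.IsLorentzian) : ∃ x, G.quad x < 0 := by
  obtain ⟨V, hV, hpos⟩ := exists_finrank_eq_sigNeg_and_negDef G.quad
  rw [hsig.2] at hV
  obtain ⟨x, y, hxy⟩ :=
    (Module.nontrivial_of_finrank_pos (R := ℝ) (M := V) (by omega)).exists_pair_ne
  have := hpos (x - y) (sub_ne_zero.2 hxy)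
  refine ⟨((x - y : V) : EuclideanSpace ℝ ι), ?_⟩
  simpa [QuadraticMap.restrict_apply] using this

/-- Replacing the coordinates by their absolute values does not increase `q`. -/
theorem quad_abs_le (G : CoxeterGram M) (x : EuclideanSpace ℝ ι) :
    G.quad (WithLp.toLp 2 fun i => |x i|) ≤ G.quad x := by
  rw [quad_apply, quad_apply, form_apply, form_apply]
  refine Finset.sum_le_sum fun i _ => Finset.sum_le_sum fun j _ => ?_
  by_cases hij : i = j
  · subst hij
    simp only [G.mat_diag, mul_one, abs_mul_abs_self, le_refl]
  · have h1 := G.mat_nonpos hij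
    have h2 : x i * x j ≤ |x i| * |x j| := by rw [← abs_mul]; exact le_abs_self _
    simp only
    nlinarith

/-- A Perron-Frobenius argument: off-diagonal entries are nonpositive, so the absolute values of a
minimizer of `q` on the unit sphere again form a minimizer, which is an eigenvector by the Rayleigh
principle. -/
theorem exists_isNormalizedEigenvector (G : CoxeterGram M) (hsig : G.IsLorentzian)
    (hirr : G.IsIrreducible) : ∃ o, G.IsNormalizedEigenvector o := by
  obtain ⟨x, hx⟩ := G.exists_quad_neg hsig
  have hx0 : x ≠ 0 := by rintro rfl; simp at hx
  have hxn : 0 < ‖x‖ := norm_pos_iff.2 hx0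
  have hxs : ‖x‖⁻¹ • x ∈ Metric.sphere (0 : EuclideanSpace ℝ ι) 1 := by
    simp [norm_smul, hxn.ne']
  obtain ⟨u, hu, hmin⟩ := (isCompact_sphere (0 : EuclideanSpace ℝ ι) 1).exists_isMinOn ⟨_, hxs⟩
    G.continuous_quad.continuousOn
  set o : EuclideanSpace ℝ ι := WithLp.toLp 2 fun i => |u i| with ho
  have hon : ‖o‖ = 1 := by
    have hu' : ‖u‖ = 1 := by simpa using hu
    rw [← hu', EuclideanSpace.norm_eq, EuclideanSpace.norm_eq]
    simp [ho]
  have homin : ∀ y ∈ Metric.sphere (0 : EuclideanSpace ℝ ι) 1, G.quad o ≤ G.quad y :=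
    fun y hy => (G.quad_abs_le u).trans (hmin hy)
  have hoq : G.quad o < 0 := by
    refine (homin _ hxs).trans_lt ?_
    rw [QuadraticMap.map_smul]
    exact mul_neg_of_pos_of_neg (by positivity) hx
  have hsymm : (Matrix.toEuclideanLin G.mat).IsSymmetric := by
    intro x y
    rw [← G.form_eq_inner, real_inner_comm, ← G.form_eq_inner, form_comm]
  have hT : IsSelfAdjoint (Matrix.toEuclideanLin G.mat).toContinuousLinearMap :=
    (ContinuousLinearMap.isSelfAdjoint_iff_isSymmetric).2 hsymm
  have hre : ∀ y, (Matrix.toEuclideanLin G.mat).toContinuousLinearMap.reApplyInnerSelf y =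
      G.quad y := by
    intro y
    rw [ContinuousLinearMap.reApplyInnerSelf_apply, quad_apply, form_eq_inner, real_inner_comm]
    rfl
  have ho0 : o ≠ 0 := by
    intro h
    rw [h] at hon
    simp at hon
  have heig := hT.hasEigenvector_of_isLocalExtrOn ho0 (Or.inl (IsMinOn.localize (fun y hy => by
    simp only [Set.mem_ofPred_eq, hre]
    exact homin y (by simpa [hon] using hy))))
  have hray : (Matrix.toEuclideanLin G.mat).toContinuousLinearMap.rayleighQuotient o =
      G.quad o := by
    rw [ContinuousLinearMap.rayleighQuotient, hre, hon]
    simp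
  rw [hray] at heig
  refine ⟨o, ⟨G.quad o, hoq, heig⟩, hon, ?_⟩
  have hnn : ∀ i, 0 ≤ o i := fun i => abs_nonneg _
  by_contra! hcon
  obtain ⟨j₀, hj₀⟩ := hcon
  obtain ⟨i₀, hi₀⟩ : ∃ i, 0 < o i := by
    by_contra! hall
    apply ho0
    ext i
    exact le_antisymm (hall i) (hnn i)
  -- At a coordinate `j` with `o j = 0` the eigenvalue equation is a vanishing sum of nonpositive
  -- terms, so the support of `o` would split off a block.
  obtain ⟨i, hi, j, hj, hij⟩ := hirr {i | 0 < o i} ⟨i₀, hi₀⟩ ⟨j₀, by simpa using hj₀⟩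
  have hi' : 0 < o i := hi
  have hj' : o j = 0 := le_antisymm (not_lt.1 hj) (hnn j)
  have hne : i ≠ j := by rintro rfl; linarith
  have heq : (Matrix.toEuclideanLin G.mat o) j = G.quad o * o j := by
    have := heig.apply_eq_smul
    have h2 := congrArg (fun v : EuclideanSpace ℝ ι => v j) this
    simpa using h2
  rw [hj', mul_zero, Matrix.ofLp_toLpLin, Matrix.toLin'_apply, Matrix.mulVec, dotProduct] at heq
  have hterm : ∀ k ∈ Finset.univ, G.mat j k * o k ≤ 0 := by
    intro k _
    by_cases hk : j = k
    · subst hk; simp [hj']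
    · exact mul_nonpos_of_nonpos_of_nonneg (G.mat_nonpos hk) (hnn k)
  have := (Finset.sum_eq_zero_iff_of_nonpos hterm).1 heq i (Finset.mem_univ i)
  rcases mul_eq_zero.1 this with h | h
  · exact hij (by rw [G.symm]; exact h)
  · linarith

theorem IsNormalizedEigenvector.height_self {G : CoxeterGram M} {o : EuclideanSpace ℝ ι}
    (ho : G.IsNormalizedEigenvector o) : height o o = 1 := by
  rw [height_eq_inner, real_inner_self_eq_norm_sq, ho.2.1, one_pow]

/-- Since `o` has norm one, its eigenvalue is `q o`. This turns pairings with `o` into heights. -/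
theorem IsNormalizedEigenvector.form_left {G : CoxeterGram M} {o : EuclideanSpace ℝ ι}
    (ho : G.IsNormalizedEigenvector o) (v : EuclideanSpace ℝ ι) :
    G.form o v = G.quad o * height o v := by
  obtain ⟨⟨c, -, hc⟩, hn, -⟩ := ho
  have h : ∀ v, G.form o v = c * height o v := by
    intro v
    rw [form_comm, form_eq_inner, hc.apply_eq_smul, inner_smul_right, real_inner_comm,
      height_eq_inner]
  rw [h, quad_apply, h, height_eq_inner o o, real_inner_self_eq_norm_sq, hn]
  ring

theorem IsNormalizedEigenvector.quad_neg {G : CoxeterGram M} {o : EuclideanSpace ℝ ι}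
    (ho : G.IsNormalizedEigenvector o) : G.quad o < 0 := by
  obtain ⟨⟨c, hc0, hc⟩, hn, -⟩ := ho
  rwa [quad_apply, form_eq_inner, hc.apply_eq_smul, inner_smul_right, real_inner_self_eq_norm_sq,
    hn, one_pow, mul_one]

/-- `q` is positive definite on the hyperplane `|v|₁ = 0`. -/
theorem IsNormalizedEigenvector.quad_pos {G : CoxeterGram M} (hsig : G.IsLorentzian)
    {o : EuclideanSpace ℝ ι} (ho : G.IsNormalizedEigenvector o) {v : EuclideanSpace ℝ ι}
    (hv : height o v = 0) (hv0 : v ≠ 0) : 0 < G.quad v := by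
  -- Otherwise `o` and `v`, being `B`-orthogonal, span a plane on which `q ≤ 0`, which leaves room
  -- for at most `n - 2` positive directions.
  by_contra! hq
  have hov : G.form o v = 0 := by rw [ho.form_left, hv, mul_zero]
  have hli : LinearIndependent ℝ ![o, v] := by
    rw [LinearIndependent.pair_iff]
    intro s t hst
    have h1 : height o (s • o + t • v) = 0 := by rw [hst]; simp [height]
    rw [height_eq_inner, inner_add_right, ← height_eq_inner, ← height_eq_inner, height_smul,
      height_smul, ho.height_self, hv] at h1
    have hs : s = 0 := by linarith
    subst hs
    simpa [hv0] using hst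
  have hneg : ∀ x ∈ Submodule.span ℝ (Set.range ![o, v]), G.quad x ≤ 0 := by
    intro x hx
    rw [Matrix.range_cons, Matrix.range_cons, Matrix.range_empty, Set.union_empty,
      Set.singleton_union, Submodule.mem_span_pair] at hx
    obtain ⟨a, b, rfl⟩ := hx
    have : G.quad (a • o + b • v) = a ^ 2 * G.quad o + b ^ 2 * G.quad v := by
      simp only [quad_apply, map_add, LinearMap.add_apply, map_smul, LinearMap.smul_apply,
        smul_eq_mul, hov, G.form_comm v o]
      ring
    rw [this]
    nlinarith [ho.quad_neg, sq_nonneg a, sq_nonneg b]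
  have h1 := QuadraticForm.sigPos_add_finrank_le_of_nonpos hneg
  rw [finrank_span_eq_card hli, finrank_euclideanSpace, Fintype.card_fin] at h1
  have := hsig.1
  omega

/-- `q` is bounded below by a positive multiple of the norm on the hyperplane `|v|₁ = 0`. -/
theorem IsNormalizedEigenvector.exists_mul_norm_sq_le {G : CoxeterGram M}
    (hsig : G.IsLorentzian) {o : EuclideanSpace ℝ ι} (ho : G.IsNormalizedEigenvector o) :
    ∃ μ : ℝ, 0 < μ ∧ ∀ v, height o v = 0 → μ * ‖v‖ ^ 2 ≤ G.quad v := by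
  set K : Set (EuclideanSpace ℝ ι) := Metric.sphere 0 1 ∩ {v | height o v = 0} with hK
  have hKc : IsCompact K := by
    apply (isCompact_sphere _ _).inter_right
    have hcont : Continuous fun v => height o v := by
      simp only [height_eq_inner]
      fun_prop
    exact isClosed_eq hcont continuous_const
  by_cases hne : K.Nonempty
  · obtain ⟨u, hu, hmin⟩ := hKc.exists_isMinOn hne G.continuous_quad.continuousOn
    have hu0 : u ≠ 0 := by
      rintro rfl
      simpa using hu.1
    refine ⟨G.quad u, ho.quad_pos hsig hu.2 hu0, fun v hv => ?_⟩
    by_cases hv0 : v = 0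
    · simp [hv0]
    have hvn : 0 < ‖v‖ := norm_pos_iff.2 hv0
    have hmem : ‖v‖⁻¹ • v ∈ K := by
      refine ⟨by simp [norm_smul, hvn.ne'], ?_⟩
      change height o _ = 0
      rw [height_smul, hv, mul_zero]
    have h : G.quad u ≤ G.quad (‖v‖⁻¹ • v) := hmin hmem
    rw [QuadraticMap.map_smul, smul_eq_mul] at h
    calc G.quad u * ‖v‖ ^ 2 ≤ ‖v‖⁻¹ * ‖v‖⁻¹ * G.quad v * ‖v‖ ^ 2 := by gcongr
      _ = G.quad v := by field_simp
  -- Here the hyperplane is zero, so any positive constant serves.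
  · refine ⟨1, one_pos, fun v hv => ?_⟩
    have hv0 : v = 0 := by
      by_contra hv0
      have hvn : 0 < ‖v‖ := norm_pos_iff.2 hv0
      refine hne ⟨‖v‖⁻¹ • v, by simp [norm_smul, hvn.ne'], ?_⟩
      change height o _ = 0
      rw [height_smul, hv, mul_zero]
    simp [hv0]

/-- Two positive vectors are not orthogonal, so the eigenvalues agree. The component of `o'`
orthogonal to `o` then has height zero and `q ≤ 0`, hence vanishes. -/
theorem IsNormalizedEigenvector.eq {G : CoxeterGram M} (hsig : G.IsLorentzian)
    {o o' : EuclideanSpace ℝ ι} (ho : G.IsNormalizedEigenvector o)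
    (ho' : G.IsNormalizedEigenvector o') : o' = o := by
  have hι : Nonempty ι := by
    by_contra h
    rw [not_nonempty_iff] at h
    have := ho.2.1
    rw [Subsingleton.elim o 0] at this
    simp at this
  have hpos : 0 < height o o' :=
    Finset.sum_pos (fun i _ => mul_pos (ho.2.2 i) (ho'.2.2 i)) Finset.univ_nonempty
  have hsym : height o' o = height o o' := by
    simp only [height_eq_inner, real_inner_comm]
  have hc : G.quad o = G.quad o' := by
    have h := ho.form_left o'
    rw [form_comm, ho'.form_left, hsym] at h
    exact (mul_right_cancel₀ hpos.ne' h).symm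
  set a := height o o' with ha
  have h0 : height o (o' - a • o) = 0 := by
    rw [height_sub, height_smul, ho.height_self]
    ring
  have hq : G.quad (o' - a • o) = G.quad o * (1 - a ^ 2) := by
    have e : G.quad (o' - a • o) = G.quad o' - 2 * a * G.form o o' + a ^ 2 * G.quad o := by
      simp only [quad_apply, map_sub, LinearMap.sub_apply, map_smul, LinearMap.smul_apply,
        smul_eq_mul, G.form_comm o' o]
      ring
    rw [e, ho.form_left, ← ha, ← hc]
    ring
  have ha1 : a ≤ 1 := by
    rw [ha, height_eq_inner]
    have := real_inner_le_norm o o'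
    rwa [ho.2.1, ho'.2.1, one_mul] at this
  have hz : o' - a • o = 0 := by
    by_contra hne
    have := ho.quad_pos hsig h0 hne
    rw [hq] at this
    have h2 : 0 ≤ 1 - a ^ 2 := by nlinarith
    nlinarith [mul_nonneg_of_nonpos_of_nonpos ho.quad_neg.le (neg_nonpos.2 h2)]
  have h1 : o' = a • o := sub_eq_zero.1 hz
  have h2 : ‖o'‖ = |a| * ‖o‖ := by
    conv_lhs => rw [h1]
    rw [norm_smul, Real.norm_eq_abs]
  rw [ho.2.1, ho'.2.1, abs_of_pos hpos, mul_one] at h2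
  rw [h1, ← h2, one_smul]

end CoxeterGram

/-! ### Lorentzian estimates and discreteness -/

namespace CoxeterGram

variable {ι : Type*} [Fintype ι] [DecidableEq ι] {W : Type*} [Group W] {M : CoxeterMatrix ι}

namespace IsNormalizedEigenvector

variable {G : CoxeterGram M} {o : EuclideanSpace ℝ ι}

/-- Two sequences in the affine hyperplane `|v|₁ = 1`, the first one in the closed ellipsoid, the
second one with `q → 0`, whose mutual form tends to zero, approach each other. -/
theorem tendsto_sub_zero (hsig : G.IsLorentzian) (ho : G.IsNormalizedEigenvector o)
    {α : Type*} {l : Filter α} {x r : α → EuclideanSpace ℝ ι}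
    (hx : ∀ᶠ n in l, height o (x n) = 1 ∧ G.quad (x n) ≤ 0) (hr : ∀ᶠ n in l, height o (r n) = 1)
    (hq : Tendsto (fun n => G.quad (r n)) l (𝓝 0))
    (hxr : Tendsto (fun n => G.form (x n) (r n)) l (𝓝 0)) :
    Tendsto (fun n => x n - r n) l (𝓝 0) := by
  obtain ⟨μ, hμ, hle⟩ := ho.exists_mul_norm_sq_le hsig
  rw [tendsto_zero_iff_norm_tendsto_zero]
  have hsq : Tendsto (fun n => ‖x n - r n‖ ^ 2) l (𝓝 0) := by
    have hlim : Tendsto (fun n => μ⁻¹ * (G.quad (r n) - 2 * G.form (x n) (r n))) l (𝓝 0) := by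
      simpa using (hq.sub (hxr.const_mul 2)).const_mul μ⁻¹
    refine tendsto_of_tendsto_of_tendsto_of_le_of_le' tendsto_const_nhds hlim
      (Eventually.of_forall fun n => by positivity) ?_
    filter_upwards [hx, hr] with n hxn hrn
    -- The difference has height zero, so `q` controls its norm; the term `q (x n) ≤ 0` is dropped
    -- from the upper bound.
    have h := hle (x n - r n) (by rw [height_sub, hxn.1, hrn, sub_self])
    have e : G.quad (x n - r n) = G.quad (x n) + G.quad (r n) - 2 * G.form (x n) (r n) := by
      simp only [quad_apply, map_sub, LinearMap.sub_apply, G.form_comm (r n) (x n)]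
      ring
    rw [e] at h
    rw [← div_eq_inv_mul, le_div_iff₀ hμ]
    linarith [hxn.2]
  have := hsq.sqrt
  simpa using this

/-- The reversed Cauchy-Schwarz inequality for the eigenvector `o`. -/
theorem mul_height_sq_le (hsig : G.IsLorentzian) (ho : G.IsNormalizedEigenvector o)
    (v : EuclideanSpace ℝ ι) : G.quad o * height o v ^ 2 ≤ G.quad v := by
  obtain ⟨μ, hμ, hle⟩ := ho.exists_mul_norm_sq_le hsig
  have h := hle (v - height o v • o)
    (by rw [height_sub, height_smul, ho.height_self, mul_one, sub_self])
  have e : G.quad (v - height o v • o) = G.quad v - G.quad o * height o v ^ 2 := by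
    have : G.quad (v - height o v • o) =
        G.quad v - 2 * height o v * G.form o v + height o v ^ 2 * G.quad o := by
      simp only [quad_apply, map_sub, LinearMap.sub_apply, map_smul, LinearMap.smul_apply,
        smul_eq_mul, G.form_comm v o]
      ring
    rw [this, ho.form_left]
    ring
  rw [e] at h
  nlinarith [sq_nonneg ‖v - height o v • o‖]

theorem height_rep_simpleRoot_neg (cs : CoxeterSystem M W) (ho : G.IsNormalizedEigenvector o)
    {w : W} {s : ι} (hs : cs.IsRightDescent w s) : height o (G.rep cs w (simpleRoot s)) < 0 := by
  have hn : G.rep cs w (simpleRoot s) ≠ 0 := by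
    rw [Ne, LinearEquiv.map_eq_zero_iff]
    simp [simpleRoot]
  obtain ⟨i, hi⟩ : ∃ i, G.rep cs w (simpleRoot s) i ≠ 0 := by
    by_contra! h
    exact hn (by ext i; exact h i)
  have hle := G.rep_simpleRoot_nonpos cs w s hs
  refine Finset.sum_neg' (fun j _ => mul_nonpos_of_nonneg_of_nonpos (ho.2.2 j).le (hle j))
    ⟨i, Finset.mem_univ i, mul_neg_of_pos_of_neg (ho.2.2 i) (lt_of_le_of_ne (hle i) hi)⟩

theorem height_rep_simpleRoot_ne_zero (cs : CoxeterSystem M W)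
    (ho : G.IsNormalizedEigenvector o) (w : W) (s : ι) :
    height o (G.rep cs w (simpleRoot s)) ≠ 0 := by
  by_cases hs : cs.IsRightDescent w s
  · exact (ho.height_rep_simpleRoot_neg cs hs).ne
  · have h := ho.height_rep_simpleRoot_neg cs (w := w * cs.simple s) (s := s) (by
      by_contra h
      exact hs ((cs.isRightDescent_iff_not_isRightDescent_mul).2 h))
    rw [map_mul, LinearEquiv.mul_apply, rep_simple, simpleReflection_simpleRoot_self, map_neg,
      height_eq_inner, inner_neg_right, ← height_eq_inner] at h
    linarith

/-- `W` acts properly: only finitely many points of the orbit of `o` have bounded height. -/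
theorem finite_abs_height_rep_le (cs : CoxeterSystem M W) (hsig : G.IsLorentzian)
    (ho : G.IsNormalizedEigenvector o) (R : ℝ) :
    {w : W | |height o (G.rep cs w o)| ≤ R}.Finite := by
  by_contra hinf
  obtain ⟨μ, hμ, hle⟩ := ho.exists_mul_norm_sq_le hsig
  have hc := ho.quad_neg
  -- The orbit lies on `q = q o`, so the height of a point bounds its component of height zero, and
  -- thus its norm.
  have hdecomp : ∀ w : W, μ * ‖G.rep cs w o - height o (G.rep cs w o) • o‖ ^ 2 ≤
      G.quad o - G.quad o * height o (G.rep cs w o) ^ 2 := by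
    intro w
    set v := G.rep cs w o with hv
    have h := hle (v - height o v • o)
      (by rw [height_sub, height_smul, ho.height_self, mul_one, sub_self])
    have : G.quad (v - height o v • o) =
        G.quad v - 2 * height o v * G.form o v + height o v ^ 2 * G.quad o := by
      simp only [quad_apply, map_sub, LinearMap.sub_apply, map_smul, LinearMap.smul_apply,
        smul_eq_mul, G.form_comm v o]
      ring
    rw [this, ho.form_left, hv, quad_rep] at h
    linarith
  let u := Set.Infinite.natEmbedding _ hinf
  have hu : ∀ n, |height o (G.rep cs (u n) o)| ≤ R := fun n => (u n).2
  have hR : 0 ≤ R := (abs_nonneg _).trans (hu 0)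
  have hbdd : ∀ n, G.rep cs (u n) o ∈ Metric.closedBall (0 : EuclideanSpace ℝ ι)
      (R + Real.sqrt (-G.quad o * R ^ 2 / μ)) := by
    intro n
    have h1 := hdecomp (u n)
    have h2 := sq_le_sq' (abs_le.1 (hu n)).1 (abs_le.1 (hu n)).2
    have h3 : ‖G.rep cs (u n) o - height o (G.rep cs (u n) o) • o‖ ≤
        Real.sqrt (-G.quad o * R ^ 2 / μ) := by
      apply Real.le_sqrt_of_sq_le
      rw [le_div_iff₀ hμ]
      nlinarith
    have h4 : ‖height o (G.rep cs (u n) o) • o‖ ≤ R := by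
      rw [norm_smul, ho.2.1, mul_one]
      exact hu n
    rw [mem_closedBall_zero_iff]
    calc ‖G.rep cs (u n) o‖ = ‖height o (G.rep cs (u n) o) • o +
          (G.rep cs (u n) o - height o (G.rep cs (u n) o) • o)‖ := by rw [add_sub_cancel]
      _ ≤ _ := (norm_add_le _ _).trans (add_le_add h4 h3)
  obtain ⟨a, -, φ, hφ, hlim⟩ := (isCompact_closedBall _ _).tendsto_subseq hbdd
  have hlim' : Tendsto (fun n => G.rep cs (u (φ n)) o) atTop (𝓝 a) := hlim
  -- Convergence along the subsequence forces these quotients to move `o` less and less; it remains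
  -- to see that an element moving `o` little is trivial.
  let g : ℕ → W := fun n => (u (φ n) : W)⁻¹ * u (φ (n + 1))
  have hquad : ∀ n, G.quad (G.rep cs (u (φ n)) o - G.rep cs (u (φ (n + 1))) o) =
      2 * G.quad o * (1 - height o (G.rep cs (g n) o)) := by
    intro n
    have e : G.rep cs (u (φ (n + 1))) o = G.rep cs (u (φ n)) (G.rep cs (g n) o) := by
      rw [← LinearEquiv.mul_apply, ← map_mul]
      simp [g]
    rw [e, ← map_sub, quad_rep]
    have : G.quad (o - G.rep cs (g n) o) =
        G.quad o + G.quad (G.rep cs (g n) o) - 2 * G.form o (G.rep cs (g n) o) := by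
      simp only [quad_apply, map_sub, LinearMap.sub_apply, G.form_comm _ o]
      ring
    rw [this, quad_rep, ho.form_left]
    ring
  have hh : Tendsto (fun n => height o (G.rep cs (g n) o)) atTop (𝓝 1) := by
    have h1 := hlim'.sub ((tendsto_add_atTop_iff_nat 1).2 hlim')
    have h2 := (G.continuous_quad.tendsto _).comp h1
    simp only [sub_self, QuadraticMap.map_zero] at h2
    have h3 := (h2.const_mul (2 * G.quad o)⁻¹).const_sub 1
    rw [mul_zero, sub_zero] at h3
    refine h3.congr fun n => ?_
    simp only [Function.comp, hquad]
    rw [inv_mul_cancel_left₀ (mul_ne_zero two_ne_zero hc.ne), sub_sub_cancel]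
  have hg : Tendsto (fun n => G.rep cs (g n) o) atTop (𝓝 o) := by
    have h1 : Tendsto (fun n => ‖G.rep cs (g n) o - height o (G.rep cs (g n) o) • o‖ ^ 2)
        atTop (𝓝 0) := by
      have h2 : Tendsto (fun n => μ⁻¹ * (G.quad o - G.quad o *
          height o (G.rep cs (g n) o) ^ 2)) atTop (𝓝 0) := by
        simpa using (((hh.pow 2).const_mul (G.quad o)).const_sub (G.quad o)).const_mul μ⁻¹
      refine squeeze_zero (fun n => by positivity) (fun n => ?_) h2
      rw [← div_eq_inv_mul, le_div_iff₀ hμ, mul_comm]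
      exact hdecomp (g n)
    have h3 : Tendsto (fun n => G.rep cs (g n) o - height o (G.rep cs (g n) o) • o)
        atTop (𝓝 0) := by
      rw [tendsto_zero_iff_norm_tendsto_zero]
      simpa using h1.sqrt
    simpa using h3.add (hh.smul_const o)
  -- The point `o` is interior to this chamber. If `g ≠ 1`, a right descent `s` of `g⁻¹` makes
  -- `g⁻¹(α_s)` negative, so `B(g o, α_s) = B(o, g⁻¹ α_s) > 0` and `g o` lies outside the chamber.
  have hcone : ∀ᶠ v in 𝓝 o, ∀ i, G.form v (simpleRoot i) < 0 := by
    rw [eventually_all]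
    intro i
    apply (G.continuous_form_left (simpleRoot i)).continuousAt.eventually_lt continuousAt_const
    rw [ho.form_left, height_simpleRoot]
    exact mul_neg_of_neg_of_pos hc (ho.2.2 i)
  obtain ⟨n, hn⟩ := (hg.eventually hcone).exists
  have hg1 : g n = 1 := by
    by_contra hne
    obtain ⟨s, hs⟩ := cs.exists_rightDescent_of_ne_one (inv_ne_one.2 hne)
    have h1 := ho.height_rep_simpleRoot_neg cs hs
    have h2 := hn s
    rw [← G.form_rep cs (g n)⁻¹, ← LinearEquiv.mul_apply, ← map_mul, inv_mul_cancel, map_one,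
      LinearEquiv.coe_one, id, ho.form_left] at h2
    nlinarith
  have h5 : u (φ n) = u (φ (n + 1)) := by
    apply Subtype.ext
    have : (u (φ n) : W)⁻¹ * u (φ (n + 1)) = 1 := hg1
    exact (inv_mul_eq_one.1 this)
  have h6 := hφ.injective (u.injective h5)
  omega

theorem _root_.CoxeterGram.rep_reflection_apply (G : CoxeterGram M) (cs : CoxeterSystem M W)
    (w : W) (i : ι) (v : EuclideanSpace ℝ ι) :
    G.rep cs (w * cs.simple i * w⁻¹) v =
      v - (2 * G.form (G.rep cs w (simpleRoot i)) v) • G.rep cs w (simpleRoot i) := by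
  have h1 : G.rep cs w (G.rep cs w⁻¹ v) = v := by
    rw [← LinearEquiv.mul_apply, ← map_mul, mul_inv_cancel, map_one, LinearEquiv.coe_one, id]
  have h2 : G.form (simpleRoot i) (G.rep cs w⁻¹ v) = G.form (G.rep cs w (simpleRoot i)) v := by
    rw [← G.form_rep cs w, h1]
  rw [map_mul, map_mul, LinearEquiv.mul_apply, LinearEquiv.mul_apply, rep_simple,
    simpleReflection_apply, map_sub, map_smul, h1, h2]

/-- The roots form a discrete closed set: only finitely many have bounded height. -/
theorem finite_roots_abs_height_le (cs : CoxeterSystem M W) (hsig : G.IsLorentzian)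
    (ho : G.IsNormalizedEigenvector o) (C : ℝ) :
    {ρ ∈ G.roots cs | |height o ρ| ≤ C}.Finite := by
  have hc := ho.quad_neg
  -- The reflection in a root `ρ` sends `o` to a point of height `1 - 2 q(o) h(ρ)²`, which gives the
  -- constant. Conversely, the image of `o` determines `ρ` up to sign.
  have hfin := ho.finite_abs_height_rep_le cs hsig (1 - 2 * G.quad o * C ^ 2)
  refine ((hfin.biUnion (t := fun t => {ρ : EuclideanSpace ℝ ι | height o ρ ≠ 0 ∧
    G.rep cs t o = o - (2 * G.quad o * height o ρ) • ρ}) ?_)).subset ?_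
  · intro t _
    rcases Set.eq_empty_or_nonempty {ρ : EuclideanSpace ℝ ι | height o ρ ≠ 0 ∧
      G.rep cs t o = o - (2 * G.quad o * height o ρ) • ρ} with h | ⟨ρ₀, h0, hρ₀⟩
    · rw [h]
      exact Set.finite_empty
    · refine (Set.toFinite {ρ₀, -ρ₀}).subset ?_
      rintro ρ ⟨h1, hρ⟩
      rw [hρ₀, sub_right_inj] at hρ
      have hsq : height o ρ ^ 2 = height o ρ₀ ^ 2 := by
        have h2 := congrArg (height o) hρ
        rw [height_smul, height_smul] at h2
        have h3 : (2 * G.quad o) * (height o ρ₀ ^ 2) = (2 * G.quad o) * (height o ρ ^ 2) := by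
          linarith
        exact (mul_left_cancel₀ (by linarith) h3).symm
      rcases sq_eq_sq_iff_eq_or_eq_neg.1 hsq with h | h
      · left
        rw [h] at hρ
        exact (smul_right_injective _ (mul_ne_zero (by linarith) h0) hρ).symm
      · right
        rw [h, mul_neg, neg_smul, ← smul_neg] at hρ
        have := smul_right_injective _ (mul_ne_zero (by linarith) h0) hρ
        rw [Set.mem_singleton_iff, this, neg_neg]
  · rintro ρ ⟨⟨w, i, rfl⟩, hC⟩
    have hrep := G.rep_reflection_apply cs w i o
    rw [G.form_comm, ho.form_left, ← mul_assoc] at hrep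
    simp only [Set.mem_iUnion]
    refine ⟨w * cs.simple i * w⁻¹, ?_, ho.height_rep_simpleRoot_ne_zero cs w i, hrep⟩
    change |height o (G.rep cs (w * cs.simple i * w⁻¹) o)| ≤ 1 - 2 * G.quad o * C ^ 2
    rw [hrep, height_sub, height_smul, ho.height_self]
    have h2 := sq_le_sq' (abs_le.1 hC).1 (abs_le.1 hC).2
    rw [abs_le]
    constructor <;> nlinarith

end IsNormalizedEigenvector

end CoxeterGram

/-! ### Normalized roots against normalized orbits -/

namespace CoxeterGram

section Hat

variable {ι : Type*} [Fintype ι]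

theorem hat_smul (o v : EuclideanSpace ℝ ι) {a : ℝ} (ha : a ≠ 0) : hat o (a • v) = hat o v := by
  rw [hat, hat, height_smul, smul_smul, mul_inv, mul_right_comm, inv_mul_cancel₀ ha, one_mul]

theorem height_hat {o v : EuclideanSpace ℝ ι} (hv : height o v ≠ 0) : height o (hat o v) = 1 := by
  rw [hat, height_smul, inv_mul_cancel₀ hv]

theorem quad_hat [DecidableEq ι] {M : CoxeterMatrix ι} (G : CoxeterGram M)
    (o v : EuclideanSpace ℝ ι) : G.quad (hat o v) = |height o v|⁻¹ ^ 2 * G.quad v := by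
  rw [hat, QuadraticMap.map_smul, smul_eq_mul, ← abs_inv, sq_abs, pow_two]

end Hat

variable {ι : Type*} [Fintype ι] [DecidableEq ι] {W : Type*} [Group W] {M : CoxeterMatrix ι}

theorem quad_rep_simpleRoot (G : CoxeterGram M) (cs : CoxeterSystem M W) (w : W) (i : ι) :
    G.quad (G.rep cs w (simpleRoot i)) = 1 := by
  rw [quad_rep, quad_apply, form_simpleRoot, mat_diag]

namespace IsNormalizedEigenvector

variable {G : CoxeterGram M} {o : EuclideanSpace ℝ ι}

theorem act_hat_simpleRoot (cs : CoxeterSystem M W) (ho : G.IsNormalizedEigenvector o) (w : W)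
    (i : ι) : G.act cs o w (hat o (simpleRoot i)) = hat o (G.rep cs w (simpleRoot i)) := by
  have h : (height o (simpleRoot i))⁻¹ ≠ 0 := by
    rw [height_simpleRoot]
    exact inv_ne_zero (ho.2.2 i).ne'
  rw [act, show hat o (simpleRoot i) = (height o (simpleRoot i))⁻¹ • simpleRoot i from rfl,
    map_smul, hat_smul o _ h]

theorem mem_region (ho : G.IsNormalizedEigenvector o) : o ∈ G.region o :=
  ⟨ho.height_self, ho.quad_neg⟩

theorem height_rep_ne_zero (cs : CoxeterSystem M W) (hsig : G.IsLorentzian)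
    (ho : G.IsNormalizedEigenvector o) (w : W) {y : EuclideanSpace ℝ ι} (hy : y ∈ G.region o) :
    height o (G.rep cs w y) ≠ 0 := by
  intro h
  have h1 := ho.mul_height_sq_le hsig (G.rep cs w y)
  rw [h, quad_rep] at h1
  have := hy.2
  simp only [ne_eq, OfNat.ofNat_ne_zero, not_false_eq_true, zero_pow, mul_zero] at h1
  linarith

theorem quad_act_neg (cs : CoxeterSystem M W) (hsig : G.IsLorentzian)
    (ho : G.IsNormalizedEigenvector o) (w : W) {y : EuclideanSpace ℝ ι} (hy : y ∈ G.region o) :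
    G.quad (G.act cs o w y) < 0 := by
  rw [act, quad_hat, quad_rep]
  have h := abs_pos.2 (ho.height_rep_ne_zero cs hsig w hy)
  exact mul_neg_of_pos_of_neg (by positivity) hy.2

variable {α : Type*} {l : Filter α}

/-- If the heights of the roots `w (α_δ)` tend to infinity, then the normalized roots and the
images of any point of `D` approach each other. -/
theorem tendsto_act_sub_hat (cs : CoxeterSystem M W) (hsig : G.IsLorentzian)
    (ho : G.IsNormalizedEigenvector o) {w : α → W} {δ : α → ι} {y : EuclideanSpace ℝ ι}
    (hy : y ∈ G.region o)
    (hh : Tendsto (fun n => |height o (G.rep cs (w n) (simpleRoot (δ n)))|) l atTop) :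
    Tendsto (fun n => G.act cs o (w n) y - hat o (G.rep cs (w n) (simpleRoot (δ n)))) l
      (𝓝 0) := by
  have hinv := hh.inv_tendsto_atTop
  refine ho.tendsto_sub_zero hsig
    (Eventually.of_forall fun n => ⟨height_hat (ho.height_rep_ne_zero cs hsig _ hy),
      (ho.quad_act_neg cs hsig (w n) hy).le⟩)
    (Eventually.of_forall fun n => height_hat (ho.height_rep_simpleRoot_ne_zero cs _ _)) ?_ ?_
  · simp only [quad_hat, quad_rep_simpleRoot, mul_one]
    simpa using hinv.pow 2
  · set K := ∑ i, |G.form y (simpleRoot i)| with hK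
    set m := Real.sqrt (G.quad y / G.quad o) with hm
    have hm0 : 0 < m := Real.sqrt_pos.2 (div_pos_of_neg_of_neg hy.2 ho.quad_neg)
    refine squeeze_zero_norm (a := fun n => m⁻¹ * K *
      |height o (G.rep cs (w n) (simpleRoot (δ n)))|⁻¹) (fun n => ?_) (by
        simpa using hinv.const_mul (m⁻¹ * K))
    -- The reversed Cauchy-Schwarz inequality gives `h(wy)² ≥ q(y)/q(o)`, uniformly in `w`.
    have h1 : m ≤ |height o (G.rep cs (w n) y)| := by
      rw [hm, ← Real.sqrt_sq_eq_abs]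
      apply Real.sqrt_le_sqrt
      have := ho.mul_height_sq_le hsig (G.rep cs (w n) y)
      rw [quad_rep] at this
      rw [div_le_iff_of_neg ho.quad_neg]
      linarith
    have h2 : |G.form y (simpleRoot (δ n))| ≤ K :=
      Finset.single_le_sum (f := fun i => |G.form y (simpleRoot i)|)
        (fun i _ => abs_nonneg _) (Finset.mem_univ (δ n))
    rw [act, hat, hat, map_smul, map_smul, LinearMap.smul_apply, form_rep, smul_eq_mul,
      smul_eq_mul, Real.norm_eq_abs, abs_mul, abs_mul, abs_inv, abs_inv]
    calc _ = |height o (G.rep cs (w n) y)|⁻¹ * |G.form y (simpleRoot (δ n))| *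
          |height o (G.rep cs (w n) (simpleRoot (δ n)))|⁻¹ := by ring
      _ ≤ _ := by gcongr

/-- A root has `q = 1`, so its normalization has `q = h⁻²`, which tends to `q z = 0` by continuity.
-/
theorem tendsto_abs_height_of_tendsto_hat (cs : CoxeterSystem M W)
    (ho : G.IsNormalizedEigenvector o) {w : α → W} {δ : α → ι} {z : EuclideanSpace ℝ ι}
    (hz : G.quad z = 0)
    (h : Tendsto (fun n => hat o (G.rep cs (w n) (simpleRoot (δ n)))) l (𝓝 z)) :
    Tendsto (fun n => |height o (G.rep cs (w n) (simpleRoot (δ n)))|) l atTop := by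
  have h1 := (G.continuous_quad.tendsto z).comp h
  simp only [Function.comp_def, quad_hat, quad_rep_simpleRoot, mul_one, hz] at h1
  have h2 := h1.sqrt
  simp only [Real.sqrt_zero, ← abs_inv, sq_abs, Real.sqrt_sq_eq_abs] at h2
  have h3 : Tendsto (fun n => |(height o (G.rep cs (w n) (simpleRoot (δ n))))⁻¹|) l (𝓝[>] 0) :=
    tendsto_nhdsWithin_iff.2 ⟨h2, Eventually.of_forall fun n =>
      abs_pos.2 (inv_ne_zero (ho.height_rep_simpleRoot_ne_zero cs _ _))⟩
  simpa only [Function.comp_def, abs_inv, Pi.inv_def, inv_inv] using h3.inv_tendsto_nhdsGT_zero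

theorem quad_eq_zero_of_tendsto_hat (cs : CoxeterSystem M W) [l.NeBot] {w : α → W} {δ : α → ι}
    {z : EuclideanSpace ℝ ι}
    (hh : Tendsto (fun n => |height o (G.rep cs (w n) (simpleRoot (δ n)))|) l atTop)
    (h : Tendsto (fun n => hat o (G.rep cs (w n) (simpleRoot (δ n)))) l (𝓝 z)) :
    G.quad z = 0 := by
  have h1 := (G.continuous_quad.tendsto z).comp h
  simp only [Function.comp_def, quad_hat, quad_rep_simpleRoot, mul_one] at h1
  have h2 := hh.inv_tendsto_atTop.pow 2
  simp only [Pi.inv_apply, ne_eq, OfNat.ofNat_ne_zero, not_false_eq_true, zero_pow] at h2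
  exact tendsto_nhds_unique h1 h2

theorem tendsto_abs_height_roots (cs : CoxeterSystem M W) (hsig : G.IsLorentzian)
    (ho : G.IsNormalizedEigenvector o) {ρ : α → EuclideanSpace ℝ ι} (hρ : ∀ n, ρ n ∈ G.roots cs)
    (hne : ∀ β ∈ G.roots cs, ∀ᶠ n in l, ρ n ≠ β) :
    Tendsto (fun n => |height o (ρ n)|) l atTop := by
  rw [tendsto_atTop]
  intro C
  have h := (ho.finite_roots_abs_height_le cs hsig C).eventually_all
    (l := l) (p := fun β n => ρ n ≠ β) |>.2 fun β hβ => hne β hβ.1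
  filter_upwards [h] with n hn
  by_contra! hlt
  exact hn (ρ n) ⟨hρ n, hlt.le⟩ rfl

theorem tendsto_abs_height_orbit (cs : CoxeterSystem M W) (hsig : G.IsLorentzian)
    (ho : G.IsNormalizedEigenvector o) {w : α → W} (hne : ∀ v, ∀ᶠ n in l, w n ≠ v) :
    Tendsto (fun n => |height o (G.rep cs (w n) o)|) l atTop := by
  rw [tendsto_atTop]
  intro C
  have h := (ho.finite_abs_height_rep_le cs hsig C).eventually_all
    (l := l) (p := fun v n => w n ≠ v) |>.2 fun v _ => hne v
  filter_upwards [h] with n hn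
  by_contra! hlt
  exact hn (w n) hlt.le rfl

/-- Some simple root has an image whose height is at least proportional to that of `w o`. -/
theorem exists_abs_height_rep_le (cs : CoxeterSystem M W) (ho : G.IsNormalizedEigenvector o)
    (w : W) : ∃ i, |height o (G.rep cs w o)| ≤
      (∑ i, o i) * |height o (G.rep cs w (simpleRoot i))| := by
  have hι : Nonempty ι := by
    by_contra h
    rw [not_nonempty_iff] at h
    have := ho.2.1
    rw [Subsingleton.elim o 0] at this
    simp at this
  obtain ⟨i, hi⟩ := Finite.exists_max fun i => |height o (G.rep cs w (simpleRoot i))|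
  refine ⟨i, ?_⟩
  have hsum : o = ∑ j, o j • simpleRoot j := by
    ext k
    simp [simpleRoot, Pi.single_apply]
  have hh : height o (G.rep cs w o) = ∑ j, o j * height o (G.rep cs w (simpleRoot j)) := by
    conv_lhs => rw [hsum]
    simp only [map_sum, map_smul]
    rw [← hsum, height_eq_inner, inner_sum]
    simp only [inner_smul_right, height_eq_inner]
  rw [hh, Finset.sum_mul]
  refine (Finset.abs_sum_le_sum_abs _ _).trans (Finset.sum_le_sum fun j _ => ?_)
  rw [abs_mul, abs_of_pos (ho.2.2 j)]
  exact mul_le_mul_of_nonneg_left (hi j) (ho.2.2 j).le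

theorem limitSet_subset_accRoots (cs : CoxeterSystem M W) (hsig : G.IsLorentzian)
    (ho : G.IsNormalizedEigenvector o) : G.limitSet cs o ⊆ G.accRoots cs o := by
  intro z hz
  rw [limitSet, mem_derivedSet, accPt_iff_frequently] at hz
  obtain ⟨x, hxz, hx⟩ := exists_seq_forall_of_frequently hz
  choose hxne w hw using hx
  have hne : ∀ v, ∀ᶠ n in atTop, w n ≠ v := by
    intro v
    -- No element recurs infinitely often: either its orbit point is `z`, which the sequence avoids,
    -- or it stays away from `z`.
    by_cases hv : G.act cs o v o = z
    · refine Eventually.of_forall fun n h => hxne n ?_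
      rw [← hv, ← hw n, h]
    · filter_upwards [hxz.eventually_ne (Ne.symm hv)] with n hn h
      exact hn (by rw [← hw n, h])
  have hwo := ho.tendsto_abs_height_orbit cs hsig hne
  -- The simple root may change with `n`; the comparison of orbit and roots is uniform in it.
  choose δ hδ using fun n => ho.exists_abs_height_rep_le cs (w n)
  have hS : 0 < ∑ i, o i :=
    Finset.sum_pos (fun i _ => ho.2.2 i) ⟨δ 0, Finset.mem_univ _⟩
  have hh : Tendsto (fun n => |height o (G.rep cs (w n) (simpleRoot (δ n)))|) atTop atTop :=
    (tendsto_const_mul_atTop_of_pos hS).1 (tendsto_atTop_mono hδ hwo)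
  have hsub := ho.tendsto_act_sub_hat cs hsig ho.mem_region hh
  have hlim : Tendsto (fun n => hat o (G.rep cs (w n) (simpleRoot (δ n)))) atTop (𝓝 z) := by
    have := hxz.sub hsub
    rw [sub_zero] at this
    refine this.congr fun n => ?_
    rw [← hw n, sub_sub_cancel]
  have hqz := quad_eq_zero_of_tendsto_hat cs hh hlim
  rw [accRoots, mem_derivedSet, accPt_iff_frequently]
  -- The limit has `q = 0` while normalized roots have `q > 0`, so the limit is never attained. In
  -- the reverse inclusion, orbit points have `q < 0`.
  refine hlim.frequently (Frequently.of_forall fun n => ⟨fun h => ?_, ?_⟩)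
  · rw [← h, quad_hat, quad_rep_simpleRoot, mul_one] at hqz
    exact ho.height_rep_simpleRoot_ne_zero cs (w n) (δ n) (by simpa using hqz)
  · exact ⟨_, ⟨w n, δ n, rfl⟩, rfl⟩

theorem accRoots_subset_limitSet (cs : CoxeterSystem M W) (hsig : G.IsLorentzian)
    (ho : G.IsNormalizedEigenvector o) : G.accRoots cs o ⊆ G.limitSet cs o := by
  intro z hz
  rw [accRoots, mem_derivedSet, accPt_iff_frequently] at hz
  obtain ⟨x, hxz, hx⟩ := exists_seq_forall_of_frequently hz
  choose hxne ρ hρ hxρ using hx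
  choose w δ hwδ using hρ
  have hne : ∀ β ∈ G.roots cs, ∀ᶠ n in atTop, ρ n ≠ β := by
    intro β _
    by_cases hβ : hat o β = z
    · refine Eventually.of_forall fun n h => hxne n ?_
      rw [← hβ, ← hxρ n, h]
    · filter_upwards [hxz.eventually_ne (Ne.symm hβ)] with n hn h
      exact hn (by rw [← hxρ n, h])
  have hh := ho.tendsto_abs_height_roots cs hsig (fun n => ⟨w n, δ n, hwδ n⟩) hne
  have hlim : Tendsto (fun n => hat o (ρ n)) atTop (𝓝 z) := hxz.congr fun n => (hxρ n).symm
  simp only [hwδ] at hh hlim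
  have hqz := quad_eq_zero_of_tendsto_hat cs hh hlim
  have hlim' : Tendsto (fun n => G.act cs o (w n) o) atTop (𝓝 z) := by
    simpa using (ho.tendsto_act_sub_hat cs hsig ho.mem_region hh).add hlim
  rw [limitSet, mem_derivedSet, accPt_iff_frequently]
  refine hlim'.frequently (Frequently.of_forall fun n => ⟨fun h => ?_, ⟨w n, rfl⟩⟩)
  have := ho.quad_act_neg cs hsig (w n) ho.mem_region
  rw [h, hqz] at this
  exact lt_irrefl _ this

end IsNormalizedEigenvector

end CoxeterGram

end

theorem theorem1p2 {ι : Type*} [Fintype ι] [DecidableEq ι] {W : Type*} [Group W]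
    {M : CoxeterMatrix ι} (cs : CoxeterSystem M W) (G : CoxeterGram M)
    (hsig : G.IsLorentzian) (hirr : G.IsIrreducible) :
    (∃! o, G.IsNormalizedEigenvector o) ∧
    ∀ o, G.IsNormalizedEigenvector o →
      G.limitSet cs o = G.accRoots cs o ∧
      ∀ (w : ℕ → W) (δ : ι), ∀ y ∈ G.region o, ∀ z ∈ G.regionBoundary o,
        (Tendsto (fun n => G.act cs o (w n) (CoxeterGram.hat o (CoxeterGram.simpleRoot δ)))
            atTop (𝓝 z) →
          Tendsto (fun n => G.act cs o (w n) y) atTop (𝓝 z)) ∧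
        ((∀ β ∈ G.roots cs, {n | G.rep cs (w n) (CoxeterGram.simpleRoot δ) = β}.Finite) →
          Tendsto (fun n => G.act cs o (w n) y) atTop (𝓝 z) →
          Tendsto (fun n => G.act cs o (w n) (CoxeterGram.hat o (CoxeterGram.simpleRoot δ)))
            atTop (𝓝 z)) := by
  obtain ⟨o, ho⟩ := G.exists_isNormalizedEigenvector hsig hirr
  refine ⟨⟨o, ho, fun o' ho' => ho.eq hsig ho'⟩, fun o ho => ⟨(ho.limitSet_subset_accRoots cs
    hsig).antisymm (ho.accRoots_subset_limitSet cs hsig), fun w δ y hy z hz => ?_⟩⟩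
  simp only [ho.act_hat_simpleRoot cs]
  refine ⟨fun h => ?_, fun hfin h => ?_⟩
  · have hh := ho.tendsto_abs_height_of_tendsto_hat cs (δ := fun _ => δ) hz.2 h
    simpa using (ho.tendsto_act_sub_hat cs hsig hy hh).add h
  · have hh := ho.tendsto_abs_height_roots cs hsig (l := atTop)
      (ρ := fun n => G.rep cs (w n) (CoxeterGram.simpleRoot δ)) (fun n => ⟨w n, δ, rfl⟩)
      fun β hβ => by
        rw [← Nat.cofinite_eq_atTop]
        exact (hfin β hβ).eventually_cofinite_notMem
    simpa using h.sub (ho.tendsto_act_sub_hat cs hsig (δ := fun _ => δ) hy hh)
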